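/- Let $G$ be a unimodular, second countable, locally compact (Hausdorff) group with Haar measure $m_G$, let $S$ be a compact generating set of $G$, and write $|g|_S=\min\{n\in\mathbb N: g\in S^n\}$ (with $S^0=\{e\}$). Let $\mu$ be a probability measure on $G$ with support $S$ which is cohomologically adapted, that is: $\mu$ is symmetric, absolutely continuous with respect to $m_G$, its density $d\mu/dm_G$ is (essentially) bounded below by a positive constant on $S$, and $\int_G |g|_S^p\,d\mu(g)<\infty$ for every $1\le p<\infty$. Let $X_n=\omega_1\cdots\omega_n$ be the random walk with independent increments $\omega_i$ of law $\mu$, and let the drift $l(\mu)$ be the almost sure (constant) value of $\lim_n |X_n|_S/n$. Suppose that $l(\mu)>0$. For a strongly continuous linear isometric representation $\pi$ of $G$ on a Banach space $E$, a $1$-cocycle is a continuous map $b:G\to E$ with $b(gh)=b(g)+\pi(g)b(h)$ for all $g,h\in G$; it is $\mu$-harmonic if $\int_G b\,d\mu=0$. Put $\|b\|_{L^p(\mu)}=\left(\int_G\|b(g)\|^p\,d\mu(g)\right)^{1/p}$ and $\rho_b(n)=\inf_{|g|_S=n}\|b(g)\|$. (1) There is a constant $C=C(\mu)>0$ such that for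 every strongly continuous unitary representation $\pi$ of $G$ on a (real or complex) Hilbert space, every $1$-cocycle $b$ for $\pi$ and every $n\in\mathbb N$, $$\rho_b(n)\le C\,\|b\|_{L^2(\mu)}\sqrt n.$$ (2) Let $q>1$ and $d>0$. There is a constant $C=C(\mu,q,d)>0$ such that for every real Banach space $E$ that is $(q,d)$-uniformly smooth, i.e. satisfies $$\|z-x_t\|^q\ge(1-t)\|z-x_0\|^q+t\|z-x_1\|^q-d\,t(1-t)\|x_0-x_1\|^q,\qquad x_t=(1-t)x_0+tx_1,$$ for all $z,x_0,x_1\in E$ and $t\in[0,1]$, every strongly continuous isometric representation $\pi$ of $G$ on $E$, every $\mu$-harmonic $1$-cocycle $b$ for $\pi$ and every $n\in\mathbb N$, $$\rho_b(n)\le C\,\|b\|_{L^q(\mu)}\,n^{1/q}.$$ -/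

import Mathlib

open MeasureTheory Filter Topology
open scoped Pointwise ENNReal

noncomputable section

/-- The word length `|g|_S = min {n ∈ ℕ : g ∈ S^n}`, where `S^0 = {1}`. (It is only used for sets `S`
whose powers exhaust the group; the value is `0` when `g` lies in no power of `S`.) -/
def wordLength {G : Type*} [Group G] (S : Set G) (g : G) : ℕ :=
  sInf {n : ℕ | g ∈ S ^ n}

/-- A probability measure `μ` on a locally compact group `G` is cohomologically adapted with respect to
the compact generating set `S`: it is symmetric, absolutely continuous with respect to the Haar measure,
its support contains `S`, its density is bounded below by a positive constant (almost everywhere) on `S`,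
and it has finite `p`-moment for every `1 ≤ p < ∞`. -/
structure IsCohomologicallyAdapted {G : Type*} [Group G] [TopologicalSpace G] [IsTopologicalGroup G]
    [LocallyCompactSpace G] [MeasurableSpace G] [BorelSpace G] (S : Set G) (μ : Measure G) : Prop where
  isCompact : IsCompact S
  generates : Subgroup.closure S = ⊤
  isProbabilityMeasure : IsProbabilityMeasure μ
  symmetric : μ.map (fun g : G => g⁻¹) = μ
  absolutelyContinuous : μ ≪ (Measure.haar : Measure G)
  subset_support : S ⊆ μ.support
  density_pos : 0 < essInf (μ.rnDeriv Measure.haar) ((Measure.haar : Measure G).restrict S)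
  finite_moment : ∀ p : ℝ, 1 ≤ p → ∫⁻ g, ENNReal.ofReal ((wordLength S g : ℝ) ^ p) ∂μ < ∞

/-- The position `X_n(ω) = ω_1 ⋯ ω_n` at time `n` of the random walk with increments `ω`
(the increments are numbered from `0` here). -/
def randomWalk {G : Type*} [Group G] (ω : ℕ → G) : ℕ → G
  | 0 => 1
  | n + 1 => randomWalk ω n * ω n

/-- `l` is the almost sure limit of `|X_n|_S / n`, where `X_n` is the random walk whose increments are
independent with law `μ`. -/
def IsEscapeRate {G : Type*} [Group G] [MeasurableSpace G] (S : Set G) (μ : Measure G) (l : ℝ) : Prop :=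
  ∀ᵐ ω ∂(Measure.infinitePi fun _ : ℕ => μ),
    Tendsto (fun n : ℕ => (wordLength S (randomWalk ω n) : ℝ) / n) atTop (𝓝 l)

open Classical in
/-- The drift `l(μ)`: the almost sure value of the limit of `|X_n|_S / n`. (For the measures considered
here the limit exists and is almost surely constant, by the subadditive ergodic theorem; the value
is `0` should there be no such limit.) -/
def drift {G : Type*} [Group G] [MeasurableSpace G] (S : Set G) (μ : Measure G) : ℝ :=
  if h : ∃ l : ℝ, IsEscapeRate S μ l then h.choose else 0

/-- Strong continuity of a linear isometric representation: `(g, x) ↦ π(g) x` is jointly continuous.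
Over a Hilbert space, a homomorphism `G →* (H ≃ₗᵢ[𝕜] H)` takes values in the unitary group of `H`. -/
def IsContinuousRep {G 𝕜 E : Type*} [Group G] [TopologicalSpace G] [RCLike 𝕜] [NormedAddCommGroup E]
    [NormedSpace 𝕜 E] (π : G →* (E ≃ₗᵢ[𝕜] E)) : Prop :=
  Continuous fun x : G × E => π x.1 x.2

/-- `b ∈ Z¹(G, π)`: `b` is continuous and `b(gh) = b(g) + π(g) b(h)`. -/
structure IsCocycle {G 𝕜 E : Type*} [Group G] [TopologicalSpace G] [RCLike 𝕜] [NormedAddCommGroup E]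
    [NormedSpace 𝕜 E] (π : G →* (E ≃ₗᵢ[𝕜] E)) (b : G → E) : Prop where
  continuous : Continuous b
  map_mul : ∀ g h : G, b (g * h) = b g + π g (b h)

/-- `b` is `μ`-harmonic: the Bochner integral `∫ b dμ` vanishes. (Cocycles are continuous and bounded on
compact sets, so they are integrable for every compactly supported probability measure on a second
countable group.) -/
def IsHarmonic {G E : Type*} [MeasurableSpace G] [NormedAddCommGroup E] [NormedSpace ℝ E]
    (μ : Measure G) (b : G → E) : Prop :=
  ∫ g, b g ∂μ = 0

/-- The norm `‖b‖_{L^p(μ)} = (∫ ‖b(g)‖^p dμ(g))^{1/p}`. -/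
def cocycleNorm {G E : Type*} [MeasurableSpace G] [NormedAddCommGroup E]
    (p : ℝ) (μ : Measure G) (b : G → E) : ℝ :=
  (∫ g, ‖b g‖ ^ p ∂μ) ^ (1 / p)

/-- The equivariant compression `ρ_b(n) = inf {‖b(g)‖ : |g|_S = n}`. -/
def compression {G E : Type*} [Group G] [NormedAddCommGroup E] (S : Set G) (b : G → E) (n : ℕ) : ℝ :=
  sInf ((fun g : G => ‖b g‖) '' {g : G | wordLength S g = n})

/-- The normed space `E` is `(q, d)`-uniformly smooth: for all `z`, `x₀`, `x₁` and `t ∈ [0, 1]`, with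
`x_t = (1 - t) x₀ + t x₁`, one has
`‖z - x_t‖^q ≥ (1 - t) ‖z - x₀‖^q + t ‖z - x₁‖^q - d t (1 - t) ‖x₀ - x₁‖^q`. -/
def IsUniformlySmooth (q d : ℝ) (E : Type*) [NormedAddCommGroup E] [NormedSpace ℝ E] : Prop :=
  ∀ z x₀ x₁ : E, ∀ t : ℝ, 0 ≤ t → t ≤ 1 →
    (1 - t) * ‖z - x₀‖ ^ q + t * ‖z - x₁‖ ^ q - d * t * (1 - t) * ‖x₀ - x₁‖ ^ q
      ≤ ‖z - ((1 - t) • x₀ + t • x₁)‖ ^ q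

end

/-! Both bounds come from comparing linear escape with slow growth of moments along the walk.
Suppose `E‖b(X_k)‖^q ≤ C k ‖b‖_q^q` for all `k`. Positive drift gives `N ≤ c n` with `|X_N| ≥ n`
outside probability `1/4`, where `c` depends only on `μ` and `S` (`exists_linear_exit_time`). Choose
`R` of order `‖b‖_q n^{1/q}` so that, by Markov, `‖b(X_k)‖ > R` has probability at most `1/4` for
each `k ≤ N`. If `‖b‖ > 2R` on the whole sphere of radius `n`, then a walk that crosses it is sent
back to `‖b‖ ≤ R` only if the increments after the crossing have `‖b‖ > R`, so this too has
probability at most `1/4` (`convPow_exit_le_quarter`). The three exceptional events would cover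
everything, yet have total mass at most `3/4`.

The moment bound is the only place where the geometry of the space enters. In the smooth case,
harmonicity and Jensen make each step add at most a constant times `‖b‖_q^q`. In the Hilbert case no
harmonicity is needed: symmetry of `μ` gives `E‖b(X_{2k})‖² ≤ 2 E‖b(X_k)‖²`, and induction on binary
digits does the rest. The cocycle identity is used only through `‖b(g⁻¹h)‖ = ‖b(h) - b(g)‖`. -/

/-- The `n`-th convolution power of a measure. -/
noncomputable def convPow {G : Type*} [Group G] [MeasurableSpace G] (μ : Measure G) : ℕ → Measure G
  | 0 => Measure.dirac 1
  | n + 1 => (convPow μ n).mconv μ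

/-! ### Convolution powers as laws of the random walk -/

section ConvPow

variable {G : Type*} [Group G] [MeasurableSpace G] (μ : Measure G)

instance isProbabilityMeasure_convPow [MeasurableMul₂ G] [IsProbabilityMeasure μ] (n : ℕ) :
    IsProbabilityMeasure (convPow μ n) := by
  induction n with
  | zero => exact Measure.dirac.isProbabilityMeasure
  | succ n ih => exact Measure.probabilitymeasure_of_probabilitymeasures_mconv _ _

lemma convPow_one [MeasurableMul₂ G] [IsProbabilityMeasure μ] : convPow μ 1 = μ :=
  Measure.dirac_one_mconv μ

lemma convPow_add [MeasurableMul₂ G] [IsProbabilityMeasure μ] (m n : ℕ) :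
    convPow μ (m + n) = (convPow μ m).mconv (convPow μ n) := by
  induction n with
  | zero => exact (Measure.mconv_dirac_one _).symm
  | succ n ih =>
    rw [← add_assoc, convPow, ih, Measure.mconv_assoc]
    rfl

lemma convPow_succ' [MeasurableMul₂ G] [IsProbabilityMeasure μ] (n : ℕ) :
    convPow μ (n + 1) = μ.mconv (convPow μ n) := by
  rw [add_comm, convPow_add, convPow_one]

lemma map_inv_mconv [MeasurableMul₂ G] [MeasurableInv G] (ν ρ : Measure G) [SFinite ν] [SFinite ρ] :
    (ν.mconv ρ).map (fun g => g⁻¹) = (ρ.map fun g => g⁻¹).mconv (ν.map fun g => g⁻¹) := by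
  unfold Measure.mconv
  rw [Measure.map_prod_map _ _ measurable_inv measurable_inv, ← Measure.prod_swap,
    Measure.map_map measurable_inv measurable_mul,
    Measure.map_map (by fun_prop) measurable_swap,
    Measure.map_map measurable_mul (by fun_prop)]
  congr 1
  ext x
  simp

lemma map_inv_convPow [MeasurableMul₂ G] [MeasurableInv G] [IsProbabilityMeasure μ]
    (hμ : μ.map (fun g => g⁻¹) = μ) (n : ℕ) :
    (convPow μ n).map (fun g => g⁻¹) = convPow μ n := by
  induction n with
  | zero => simp [convPow, Measure.map_dirac' measurable_inv]
  | succ n ih => rw [convPow, map_inv_mconv, ih, hμ, ← convPow_succ', convPow]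

lemma measurable_randomWalk [MeasurableMul₂ G] (n : ℕ) :
    Measurable fun ω : ℕ → G => randomWalk ω n := by
  induction n with
  | zero => exact measurable_const
  | succ n ih => exact ih.mul (measurable_pi_apply n)

lemma randomWalk_congr {G : Type*} [Group G] {ω ω' : ℕ → G} {n : ℕ} (h : ∀ i < n, ω i = ω' i) :
    randomWalk ω n = randomWalk ω' n := by
  induction n with
  | zero => rfl
  | succ n ih =>
    simp only [randomWalk]
    rw [ih fun i hi => h i (by omega), h n (by omega)]

lemma map_randomWalk [MeasurableMul₂ G] [IsProbabilityMeasure μ] (n : ℕ) :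
    (Measure.infinitePi fun _ : ℕ => μ).map (fun ω => randomWalk ω n) = convPow μ n := by
  classical
  induction n with
  | zero => simp [randomWalk, convPow]
  | succ n ih =>
    have hind := (ProbabilityTheory.iIndepFun_infinitePi (P := fun _ : ℕ => μ)
      (X := fun _ ω => ω) (fun _ => measurable_id)).indepFun_finset (Finset.range n) {n}
      (by simp) (fun i => measurable_pi_apply i)
    -- `X_n` as a function of the first `n` increments alone, hence independent of the next one; the
    -- filler `1` is never read.
    let F : (Finset.range n → G) → G := fun y =>
      randomWalk (fun i => if h : i ∈ Finset.range n then y ⟨i, h⟩ else 1) n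
    have hF : Measurable F := by
      refine (measurable_randomWalk n).comp (measurable_pi_lambda _ fun i => ?_)
      by_cases h : i ∈ Finset.range n
      · simpa only [h, dite_true] using measurable_pi_apply _
      · simpa only [h, dite_false] using measurable_const
    have h2 := hind.comp hF (measurable_pi_apply (⟨n, by simp⟩ : ({n} : Finset ℕ)))
    have e1 : (F ∘ fun (ω : ℕ → G) (i : Finset.range n) => ω i) = fun ω => randomWalk ω n := by
      ext ω
      refine randomWalk_congr fun i hi => ?_
      simp [hi]
    rw [e1] at h2
    have h3 := h2.map_mul_eq_map_mconv_map (measurable_randomWalk n) (measurable_pi_apply n)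
    rw [ih] at h3
    have h4 : (Measure.infinitePi fun _ : ℕ => μ).map
      ((fun y : ({n} : Finset ℕ) → G => y ⟨n, by simp⟩) ∘ fun ω (i : ({n} : Finset ℕ)) => ω i) = μ :=
      Measure.infinitePi_map_eval (fun _ : ℕ => μ) n
    rw [h4] at h3
    exact h3

lemma convPow_compl_pow [MeasurableMul₂ G] [IsProbabilityMeasure μ] {S : Set G}
    (hS : μ Sᶜ = 0) (hm : ∀ n : ℕ, MeasurableSet (S ^ n)) (n : ℕ) : convPow μ n (S ^ n)ᶜ = 0 := by
  induction n with
  | zero =>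
    rw [convPow, Measure.dirac_apply' _ (hm 0).compl]
    simp
  | succ n ih =>
    rw [convPow, Measure.mconv, Measure.map_apply measurable_mul (hm _).compl]
    have h1 : ∀ᵐ x ∂(convPow μ n), x ∈ S ^ n := ih
    have h2 : ∀ᵐ x ∂μ, x ∈ S := hS
    have h3 : ∀ᵐ z ∂((convPow μ n).prod μ), z.1 * z.2 ∈ S ^ (n + 1) := by
      filter_upwards [Measure.quasiMeasurePreserving_fst.ae h1,
        Measure.quasiMeasurePreserving_snd.ae h2] with z hz1 hz2
      rw [pow_succ]
      exact Set.mul_mem_mul hz1 hz2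
    exact h3

end ConvPow

/-! ### Word length and the symmetry of the support -/

section WordLength

variable {G : Type*} [Group G] {S : Set G}

lemma exists_mem_pow (hinv : S⁻¹ = S) (hgen : Subgroup.closure S = ⊤) (g : G) :
    ∃ n : ℕ, g ∈ S ^ n := by
  have hg : g ∈ Subgroup.closure S := hgen ▸ Subgroup.mem_top g
  induction hg using Subgroup.closure_induction with
  | mem x hx => exact ⟨1, by simpa using hx⟩
  | one => exact ⟨0, by simp⟩
  | mul x y _ _ hx hy =>
    obtain ⟨m, hm⟩ := hx
    obtain ⟨n, hn⟩ := hy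
    exact ⟨m + n, pow_add S m n ▸ Set.mul_mem_mul hm hn⟩
  | inv x _ hx =>
    obtain ⟨n, hn⟩ := hx
    exact ⟨n, by rw [← hinv, inv_pow]; simpa using hn⟩

lemma mem_pow_wordLength (hS : ∀ g : G, ∃ n : ℕ, g ∈ S ^ n) (g : G) : g ∈ S ^ wordLength S g :=
  Nat.sInf_mem (s := {n : ℕ | g ∈ S ^ n}) (hS g)

lemma wordLength_one : wordLength S (1 : G) = 0 :=
  Nat.sInf_eq_zero.2 (Or.inl (by simp))

lemma wordLength_mul_le (hS : ∀ g : G, ∃ n : ℕ, g ∈ S ^ n) (g : G) {s : G} (hs : s ∈ S) :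
    wordLength S (g * s) ≤ wordLength S g + 1 :=
  Nat.sInf_le (by
    rw [Set.mem_ofPred_eq, pow_succ]
    exact Set.mul_mem_mul (mem_pow_wordLength hS g) hs)

lemma measurable_wordLength [MeasurableSpace G] (hS : ∀ g : G, ∃ n : ℕ, g ∈ S ^ n)
    (hm : ∀ n : ℕ, MeasurableSet (S ^ n)) : Measurable (wordLength S) := by
  classical
  have h : wordLength S = fun g => Nat.find (hS g) := by
    ext g
    exact Nat.sInf_def (hS g)
  rw [h]
  exact measurable_find hS hm

lemma isCompact_set_pow [TopologicalSpace G] [ContinuousMul G] (hS : IsCompact S) (n : ℕ) :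
    IsCompact (S ^ n) := by
  induction n with
  | zero => simp
  | succ n ih => rw [pow_succ]; exact ih.mul hS

/-- Makes `S` symmetric, so that the powers of `S` itself exhaust the group it generates. -/
lemma inv_support [TopologicalSpace G] [IsTopologicalGroup G] [MeasurableSpace G] [BorelSpace G]
    (μ : Measure G) (hμ : μ.map (fun g => g⁻¹) = μ) : μ.support⁻¹ = μ.support := by
  have key : ∀ x ∈ μ.support, x⁻¹ ∈ μ.support := by
    intro x hx
    rw [Measure.mem_support_iff_forall] at hx ⊢
    intro U hU
    obtain ⟨V, hVU, hV, hxV⟩ := mem_nhds_iff.1 hU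
    have h := hx V⁻¹ (hV.inv.mem_nhds (by simpa using hxV))
    rw [← hμ, Measure.map_apply measurable_inv hV.inv.measurableSet] at h
    refine (h.trans_le (le_of_eq ?_)).trans_le (measure_mono hVU)
    congr 1
    ext y
    simp
  ext x
  exact ⟨fun hx => by simpa using key _ hx, fun hx => key x hx⟩

end WordLength

/-! ### Linear escape from balls -/

section Drift

variable {G : Type*} [Group G] [MeasurableSpace G] [MeasurableMul₂ G] {S : Set G} {μ : Measure G}

/-- Positive drift forces the walk to leave the ball of radius `n` within linear time, with
probability at least `3/4`. -/
lemma exists_linear_exit_time [IsProbabilityMeasure μ] (hmeas : Measurable (wordLength S))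
    (hdrift : 0 < drift S μ) :
    ∃ c : ℝ, 0 < c ∧ ∀ n : ℕ, 1 ≤ n → ∃ N : ℕ, (N : ℝ) ≤ c * n ∧
      convPow μ N {x | wordLength S x < n} ≤ 1 / 4 := by
  obtain ⟨l, hl, hlim⟩ : ∃ l : ℝ, 0 < l ∧ IsEscapeRate S μ l := by
    unfold drift at hdrift
    split_ifs at hdrift with h
    · exact ⟨h.choose, hdrift, h.choose_spec⟩
    · exact absurd hdrift (lt_irrefl 0)
  set P := Measure.infinitePi fun _ : ℕ => μ with hP
  -- The event of being too slow at some time after `M`. These decrease to a null set, so one of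
  -- them has mass below `1/4`.
  let B : ℕ → Set (ℕ → G) := fun M =>
    {ω | ∃ N : ℕ, M ≤ N ∧ (wordLength S (randomWalk ω N) : ℝ) < l / 2 * N}
  have hBm : ∀ M, MeasurableSet (B M) := by
    intro M
    have : B M = ⋃ N : ℕ, ⋃ _ : M ≤ N,
        {ω | (wordLength S (randomWalk ω N) : ℝ) < l / 2 * N} := by
      ext ω
      simp [B]
    rw [this]
    refine MeasurableSet.iUnion fun N => MeasurableSet.iUnion fun _ => ?_
    refine measurableSet_lt ?_ measurable_const
    exact (measurable_from_top (f := fun n : ℕ => (n : ℝ))).comp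
      (hmeas.comp (measurable_randomWalk N))
  have hBanti : Antitone B := fun M M' hM ω ⟨N, hN, h⟩ => ⟨N, hM.trans hN, h⟩
  have hnull : P (⋂ M, B M) = 0 := by
    refine measure_mono_null ?_ (show P {ω | ¬ Tendsto
      (fun n : ℕ => (wordLength S (randomWalk ω n) : ℝ) / n) atTop (𝓝 l)} = 0 from hlim)
    intro ω hω ht
    have hev := (ht.eventually_const_lt (half_lt_self hl)).and (eventually_ge_atTop 1)
    obtain ⟨M, hM⟩ := eventually_atTop.1 hev
    obtain ⟨N, hN, h⟩ := Set.mem_iInter.1 hω M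
    obtain ⟨h1, h2⟩ := hM N hN
    have hN0 : (0 : ℝ) < N := by exact_mod_cast h2
    rw [lt_div_iff₀ hN0] at h1
    exact lt_asymm h h1
  have htend := tendsto_measure_iInter_atTop (μ := P) (fun M => (hBm M).nullMeasurableSet) hBanti
    ⟨0, measure_ne_top _ _⟩
  rw [hnull] at htend
  obtain ⟨M, hM⟩ := (htend.eventually_lt_const
    (show (0 : ℝ≥0∞) < 1 / 4 by simp)).exists
  -- At time `N ≥ 2n/l` beyond `M`, speed `l/2` already gives length `n`. The summands `M` and `1`
  -- (from the ceiling) are absorbed by `n ≥ 1`.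
  refine ⟨M + (2 / l + 1), by positivity, fun n hn => ⟨max M ⌈2 / l * n⌉₊, ?_, ?_⟩⟩
  · have hn' : (1 : ℝ) ≤ n := by exact_mod_cast hn
    have hceil := (Nat.ceil_lt_add_one (show 0 ≤ 2 / l * (n : ℝ) by positivity)).le
    have h0 : 0 ≤ 2 / l * (n : ℝ) := by positivity
    have hM0 : (0 : ℝ) ≤ M := Nat.cast_nonneg M
    push_cast
    refine max_le ?_ ?_ <;> nlinarith
  · rw [← map_randomWalk, Measure.map_apply (measurable_randomWalk _)
      (measurableSet_lt hmeas measurable_const)]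
    refine (measure_mono fun ω hω => ?_).trans hM.le
    refine ⟨max M ⌈2 / l * n⌉₊, le_max_left _ _, ?_⟩
    have hω' : (wordLength S (randomWalk ω (max M ⌈2 / l * n⌉₊)) : ℝ) < n := by
      exact_mod_cast hω
    refine hω'.trans_le ?_
    have h1 : 2 / l * (n : ℝ) ≤ (max M ⌈2 / l * n⌉₊ : ℕ) :=
      (Nat.le_ceil _).trans (by exact_mod_cast le_max_right _ _)
    calc (n : ℝ) = l / 2 * (2 / l * n) := by field_simp
      _ ≤ _ := by gcongr

end Drift

/-! ### Markov's inequality, norm identities and the crossing argument -/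

section Moments

lemma measure_lt_le_quarter {X : Type*} [MeasurableSpace X] {ν : Measure X}
    [IsProbabilityMeasure ν] {f : X → ℝ} (hf0 : ∀ x, 0 ≤ f x) (hf : Integrable f ν) {A : ℝ}
    (hA : ∫ x, f x ∂ν ≤ A) : ν {x | 4 * A < f x} ≤ 1 / 4 := by
  have hA0 : 0 ≤ A := (integral_nonneg hf0).trans hA
  -- For `A = 0` Markov gives nothing; there `f` vanishes almost everywhere, and the strict
  -- inequality excludes it.
  rcases hA0.eq_or_lt with rfl | hpos
  · have h0 : f =ᵐ[ν] 0 :=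
      (integral_eq_zero_iff_of_nonneg hf0 hf).1 (le_antisymm hA (integral_nonneg hf0))
    have : ν {x | 4 * 0 < f x} = 0 := by
      refine measure_mono_null (fun x hx => ?_) (show ν {x | ¬ f x = 0} = 0 from h0)
      simp only [mul_zero, Set.mem_ofPred_eq] at hx ⊢
      exact hx.ne'
    rw [this]
    exact zero_le
  · have h := mul_meas_ge_le_integral_of_nonneg (Eventually.of_forall hf0) hf (4 * A)
    have h1 : ν.real {x | 4 * A ≤ f x} ≤ 1 / 4 := by nlinarith
    have h2 : ν {x | 4 * A ≤ f x} ≤ ENNReal.ofReal (1 / 4) := by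
      rw [Measure.real] at h1
      exact (ENNReal.le_ofReal_iff_toReal_le (measure_ne_top _ _) (by norm_num)).2 h1
    refine (measure_mono fun x hx => ?_).trans (h2.trans (le_of_eq ?_))
    · exact le_of_lt (show 4 * A < f x from hx)
    · rw [ENNReal.ofReal_div_of_pos (by norm_num)]
      simp

lemma Continuous.integrable_of_compl_isCompact_null {X F : Type*} [TopologicalSpace X]
    [SecondCountableTopology X] [MeasurableSpace X] [OpensMeasurableSpace X]
    [NormedAddCommGroup F] {ν : Measure X} [IsFiniteMeasure ν] {K : Set X} (hK : IsCompact K)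
    (hν : ν Kᶜ = 0) {f : X → F} (hf : Continuous f) : Integrable f ν := by
  obtain ⟨C, hC⟩ := hK.exists_bound_of_continuousOn hf.continuousOn
  have hae : ∀ᵐ x ∂ν, x ∈ K := hν
  exact Integrable.of_bound hf.aestronglyMeasurable C (hae.mono hC)

lemma rpow_integral_le {X : Type*} [MeasurableSpace X] {ν : Measure X} [IsProbabilityMeasure ν]
    {f : X → ℝ} (hf0 : ∀ x, 0 ≤ f x) {q : ℝ} (hq : 1 ≤ q) (hf : Integrable f ν)
    (hfq : Integrable (fun x => f x ^ q) ν) : (∫ x, f x ∂ν) ^ q ≤ ∫ x, f x ^ q ∂ν :=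
  (convexOn_rpow hq).map_integral_le
    (Real.continuous_rpow_const (by linarith)).continuousOn isClosed_Ici
    (Eventually.of_forall hf0) hf hfq

variable {G : Type*} [Group G] {E : Type*} [NormedAddCommGroup E] {b : G → E}

lemma map_one_of_norm_inv_mul (hb : ∀ g h, ‖b (g⁻¹ * h)‖ = ‖b h - b g‖) : b 1 = 0 := by
  have h := hb 1 1
  rw [sub_self, norm_zero] at h
  simpa using h

lemma norm_inv_of_norm_inv_mul (hb : ∀ g h, ‖b (g⁻¹ * h)‖ = ‖b h - b g‖) (g : G) :
    ‖b g⁻¹‖ = ‖b g‖ := by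
  have h := hb g 1
  rwa [map_one_of_norm_inv_mul hb, mul_one, zero_sub, norm_neg] at h

lemma norm_mul_of_norm_inv_mul (hb : ∀ g h, ‖b (g⁻¹ * h)‖ = ‖b h - b g‖) (g h : G) :
    ‖b (g * h)‖ = ‖b h - b g⁻¹‖ := by
  rw [← hb, inv_inv]

lemma norm_mul_le_of_norm_inv_mul (hb : ∀ g h, ‖b (g⁻¹ * h)‖ = ‖b h - b g‖) (g h : G) :
    ‖b (g * h)‖ ≤ ‖b g‖ + ‖b h‖ := by
  rw [norm_mul_of_norm_inv_mul hb, ← norm_inv_of_norm_inv_mul hb g, add_comm]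
  exact norm_sub_le _ _

lemma norm_sub_le_of_norm_inv_mul (hb : ∀ g h, ‖b (g⁻¹ * h)‖ = ‖b h - b g‖) (g h : G) :
    ‖b g‖ - ‖b h‖ ≤ ‖b (g * h)‖ := by
  rw [norm_mul_of_norm_inv_mul hb, ← norm_inv_of_norm_inv_mul hb g, norm_sub_rev]
  exact norm_sub_norm_le _ _

/-- Conditioning on the first step: starting inside the ball of radius `n`, a walk with steps in `S`
must cross the sphere of radius `n` in order to leave the ball; if `b` is large on this sphere, then
it is unlikely to be small afterwards. -/
lemma convPow_exit_le_quarter [MeasurableSpace G] [MeasurableMul₂ G] {μ : Measure G}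
    [IsProbabilityMeasure μ] {S : Set G} (hμS : μ Sᶜ = 0) (hS : ∀ g : G, ∃ n : ℕ, g ∈ S ^ n)
    (hmeas : Measurable (wordLength S)) (hbm : Measurable fun g => ‖b g‖)
    (hb : ∀ g h, ‖b (g⁻¹ * h)‖ = ‖b h - b g‖) {n N : ℕ} {R : ℝ}
    (hR : ∀ k ≤ N, convPow μ k {x | R < ‖b x‖} ≤ 1 / 4)
    (hfar : ∀ g, wordLength S g = n → 2 * R < ‖b g‖) :
    ∀ k ≤ N, ∀ g, wordLength S g ≤ n →
      convPow μ k {x | n ≤ wordLength S (g * x) ∧ ‖b (g * x)‖ ≤ R} ≤ 1 / 4 := by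
  intro k
  -- On the sphere `‖b(gx)‖ ≥ ‖b(g)‖ - ‖b(x)‖ > 2R - ‖b(x)‖`, so a small value after `g` forces
  -- `‖b(x)‖ > R`.
  have hsphere : ∀ k ≤ N, ∀ g, wordLength S g = n →
      convPow μ k {x | n ≤ wordLength S (g * x) ∧ ‖b (g * x)‖ ≤ R} ≤ 1 / 4 := by
    intro k hk g hg
    refine (measure_mono fun x hx => ?_).trans (hR k hk)
    have h1 := hfar g hg
    have h2 := norm_sub_le_of_norm_inv_mul hb g x
    have h3 := hx.2
    simp only [Set.mem_ofPred_eq]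
    linarith
  have hA : MeasurableSet {x | n ≤ wordLength S x ∧ ‖b x‖ ≤ R} :=
    (measurableSet_le measurable_const hmeas).inter (measurableSet_le hbm measurable_const)
  induction k with
  | zero =>
    intro hk g hg
    rcases hg.eq_or_lt with hg | hg
    · exact hsphere 0 hk g hg
    · have h0 : MeasurableSet {x | n ≤ wordLength S (g * x) ∧ ‖b (g * x)‖ ≤ R} :=
        (measurable_const_mul g) hA
      rw [convPow, Measure.dirac_apply' _ h0]
      simp [hg]
  | succ k ih =>
    intro hk g hg
    rcases hg.eq_or_lt with hg | hg
    · exact hsphere _ hk g hg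
    have hA' : MeasurableSet {x | n ≤ wordLength S (g * x) ∧ ‖b (g * x)‖ ≤ R} :=
      (measurable_const_mul g) hA
    rw [convPow_succ', ← lintegral_indicator_one hA',
      Measure.lintegral_mconv (measurable_one.indicator hA')]
    -- From strictly inside the ball one step cannot jump over the sphere, so the induction
    -- hypothesis applies at `g * s`.
    have hstep : ∀ᵐ s ∂μ, ∫⁻ y, ({x | n ≤ wordLength S (g * x) ∧ ‖b (g * x)‖ ≤ R}.indicator
        (1 : G → ℝ≥0∞)) (s * y) ∂(convPow μ k) ≤ 1 / 4 := by
      filter_upwards [show ∀ᵐ s ∂μ, s ∈ S from hμS] with s hs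
      have h := ih (by omega) (g * s) ((wordLength_mul_le hS g hs).trans hg)
      have hA'' : MeasurableSet {x | n ≤ wordLength S (g * s * x) ∧ ‖b (g * s * x)‖ ≤ R} :=
        (measurable_const_mul (g * s)) hA
      rw [← lintegral_indicator_one hA''] at h
      refine le_trans (le_of_eq (lintegral_congr fun y => ?_)) h
      simp only [Set.indicator, Set.mem_ofPred_eq, mul_assoc, Pi.one_apply]
    calc _ ≤ ∫⁻ _, (1 / 4 : ℝ≥0∞) ∂μ := lintegral_mono_ae hstep
      _ = 1 / 4 := by simp

end Moments

/-! ### From moment growth to compression -/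

section Compression

lemma continuous_norm_sq {X F : Type*} [TopologicalSpace X] [NormedAddCommGroup F] {f : X → F}
    (hf : Continuous f) : Continuous fun x => ‖f x‖ ^ 2 := hf.norm.pow 2

variable {G : Type*} [Group G] [TopologicalSpace G] [IsTopologicalGroup G]
  [SecondCountableTopology G] [MeasurableSpace G] [BorelSpace G]
  {μ : Measure G} [IsProbabilityMeasure μ]

/-- A linear bound on the `q`-th moments of `b` along the random walk bounds the compression of `b`. -/
lemma compression_le_of_moment_le {S : Set G} {E : Type*} [NormedAddCommGroup E] {b : G → E}
    (hμS : μ Sᶜ = 0) (hS : ∀ g : G, ∃ n : ℕ, g ∈ S ^ n) (hmeas : Measurable (wordLength S))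
    (hbc : Continuous b) (hb : ∀ g h, ‖b (g⁻¹ * h)‖ = ‖b h - b g‖) {q C c : ℝ} (hq : 0 < q)
    (hC : 0 ≤ C) (hint : ∀ k, Integrable (fun g => ‖b g‖ ^ q) (convPow μ k))
    (hmom : ∀ k : ℕ, ∫ g, ‖b g‖ ^ q ∂(convPow μ k) ≤ C * k * ∫ g, ‖b g‖ ^ q ∂μ)
    (hexit : ∀ n : ℕ, 1 ≤ n → ∃ N : ℕ, (N : ℝ) ≤ c * n ∧
      convPow μ N {x | wordLength S x < n} ≤ 1 / 4) (hc : 0 ≤ c) (n : ℕ) :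
    compression S b n ≤ 2 * (4 * C * c) ^ (1 / q) * cocycleNorm q μ b * (n : ℝ) ^ (1 / q) := by
  have hle : ∀ g, wordLength S g = n → compression S b n ≤ ‖b g‖ := fun g hg =>
    csInf_le ⟨0, by rintro _ ⟨x, -, rfl⟩; exact norm_nonneg _⟩ ⟨g, hg, rfl⟩
  rcases Nat.eq_zero_or_pos n with rfl | hn
  · have h := hle 1 wordLength_one
    rw [map_one_of_norm_inv_mul hb, norm_zero] at h
    simpa [Real.zero_rpow (inv_pos.2 hq).ne'] using h
  set V := ∫ g, ‖b g‖ ^ q ∂μ with hV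
  have hV0 : 0 ≤ V := integral_nonneg fun g => by positivity
  obtain ⟨N, hN, hNexit⟩ := hexit n hn
  -- Bounds the moments at all times `k ≤ N` at once, since the crossing time is not known.
  set A := C * (c * n) * V with hA
  have hA0 : 0 ≤ A := by positivity
  set R := (4 * A) ^ (1 / q) with hRdef
  have hR0 : 0 ≤ R := by positivity
  have hRq : R ^ q = 4 * A := by
    rw [hRdef, ← Real.rpow_mul (by positivity), one_div_mul_cancel hq.ne', Real.rpow_one]
  have hR : ∀ k ≤ N, convPow μ k {x | R < ‖b x‖} ≤ 1 / 4 := by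
    intro k hk
    have hkA : ∫ g, ‖b g‖ ^ q ∂(convPow μ k) ≤ A := by
      refine (hmom k).trans ?_
      have hk' : (k : ℝ) ≤ c * n := le_trans (by exact_mod_cast hk) hN
      exact mul_le_mul_of_nonneg_right (mul_le_mul_of_nonneg_left hk' hC) hV0
    refine (measure_mono fun x hx => ?_).trans
      (measure_lt_le_quarter (fun x => by positivity) (hint k) hkA)
    have hx' : R < ‖b x‖ := hx
    have := Real.rpow_lt_rpow hR0 hx' hq
    rwa [hRq] at this
  obtain ⟨g, hg, hgR⟩ : ∃ g, wordLength S g = n ∧ ‖b g‖ ≤ 2 * R := by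
    by_contra! hfar
    have h := convPow_exit_le_quarter hμS hS hmeas hbc.norm.measurable hb hR hfar N le_rfl 1
      (by simp [wordLength_one])
    simp only [one_mul] at h
    have hcover : (Set.univ : Set G) ⊆ {x | n ≤ wordLength S x ∧ ‖b x‖ ≤ R} ∪
        ({x | R < ‖b x‖} ∪ {x | wordLength S x < n}) := by
      intro x _
      by_cases h1 : wordLength S x < n
      · exact Or.inr (Or.inr h1)
      by_cases h2 : R < ‖b x‖
      · exact Or.inr (Or.inl h2)
      · exact Or.inl ⟨not_lt.1 h1, not_lt.1 h2⟩
    have h1 : (1 : ℝ≥0∞) ≤ 1 / 4 + (1 / 4 + 1 / 4) := by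
      refine (measure_univ (μ := convPow μ N)).symm.le.trans ?_
      exact (measure_mono hcover).trans ((measure_union_le _ _).trans
        (add_le_add h ((measure_union_le _ _).trans (add_le_add (hR N le_rfl) hNexit))))
    have h2 := ENNReal.toReal_mono (by finiteness) h1
    rw [ENNReal.toReal_add (by finiteness) (by finiteness),
      ENNReal.toReal_add (by finiteness) (by finiteness)] at h2
    norm_num at h2
  refine (hle g hg).trans (hgR.trans (le_of_eq ?_))
  rw [hRdef, cocycleNorm, ← hV, mul_assoc, mul_assoc, ← Real.mul_rpow hV0 (Nat.cast_nonneg n),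
    ← Real.mul_rpow (by positivity) (by positivity)]
  congr 2
  ring

end Compression

/-! ### Moments in uniformly smooth spaces -/

section UniformlySmooth

lemma IsUniformlySmooth.rpow_norm_sub_le {E : Type*} [NormedAddCommGroup E] [NormedSpace ℝ E]
    {q d : ℝ} (hE : IsUniformlySmooth q d E) (u v : E) :
    ‖v - u‖ ^ q ≤ 2 * ‖u‖ ^ q + d / 2 * 2 ^ q * ‖v‖ ^ q - ‖u + v‖ ^ q := by
  -- At the midpoint of `-v` and `v`, smoothness becomes a one-sided parallelogram inequality.
  have h := hE u (-v) v (1 / 2) (by norm_num) (by norm_num)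
  have e1 : ‖-v - v‖ ^ q = 2 ^ q * ‖v‖ ^ q := by
    rw [show -v - v = (-2 : ℝ) • v by module, norm_smul, Real.mul_rpow (by positivity) (by positivity)]
    norm_num
  have e2 : u - ((1 - (1 / 2 : ℝ)) • (-v) + (1 / 2 : ℝ) • v) = u := by module
  rw [e1, e2, sub_neg_eq_add, norm_sub_rev u v] at h
  linarith

variable {G : Type*} [Group G] [TopologicalSpace G] [IsTopologicalGroup G] [T2Space G]
  [SecondCountableTopology G] [MeasurableSpace G] [BorelSpace G]
  {μ : Measure G} [IsProbabilityMeasure μ] {S : Set G}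

lemma Continuous.integrable_convPow (hcomp : IsCompact S) (hμS : μ Sᶜ = 0) {F : Type*}
    [NormedAddCommGroup F] {f : G → F} (hf : Continuous f) (n : ℕ) : Integrable f (convPow μ n) :=
  hf.integrable_of_compl_isCompact_null (isCompact_set_pow hcomp n)
    (convPow_compl_pow μ hμS (fun n => (isCompact_set_pow hcomp n).measurableSet) n)

/-- With `u = b(g⁻¹)`, the two-point inequality bounds `‖b(h) - u‖^q` by `2‖u‖^q - ‖u + b(h)‖^q`
plus an error in `‖b(h)‖^q`. Since `b` has mean zero, Jensen cancels one copy of `‖u‖^q`, leaving an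
additive error per step. -/
lemma moment_le_of_isUniformlySmooth (hcomp : IsCompact S) (hμS : μ Sᶜ = 0) {E : Type*}
    [NormedAddCommGroup E] [NormedSpace ℝ E] [CompleteSpace E] {q d : ℝ} (hq : 1 < q)
    (hE : IsUniformlySmooth q d E) {b : G → E} (hbc : Continuous b)
    (hb : ∀ g h, ‖b (g⁻¹ * h)‖ = ‖b h - b g‖) (hharm : ∫ g, b g ∂μ = 0) (k : ℕ) :
    ∫ g, ‖b g‖ ^ q ∂(convPow μ k) ≤ d / 2 * 2 ^ q * k * ∫ g, ‖b g‖ ^ q ∂μ := by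
  have hq0 : 0 ≤ q := by linarith
  have hpow : ∀ {f : G → E}, Continuous f → Continuous fun g => ‖f g‖ ^ q := fun hf =>
    hf.norm.rpow_const fun _ => Or.inr hq0
  have hμint : ∀ {F : Type _} [NormedAddCommGroup F] {f : G → F}, Continuous f →
      Integrable f μ := fun hf => hf.integrable_of_compl_isCompact_null hcomp hμS
  have hμint' : ∀ {f : G → ℝ}, Continuous f →
      Integrable f μ := fun hf => hf.integrable_of_compl_isCompact_null hcomp hμS
  induction k with
  | zero =>
    rw [convPow, integral_dirac, map_one_of_norm_inv_mul hb, norm_zero,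
      Real.zero_rpow (by linarith)]
    simp
  | succ k ih =>
    set V := ∫ g, ‖b g‖ ^ q ∂μ with hV
    rw [convPow, integral_mconv ((hpow hbc).integrable_convPow hcomp hμS (k + 1))]
    have hstep : ∀ g, ∫ h, ‖b (g * h)‖ ^ q ∂μ ≤ ‖b g‖ ^ q + d / 2 * 2 ^ q * V := by
      intro g
      set u := b g⁻¹ with hu
      have hjensen : ‖u‖ ^ q ≤ ∫ h, ‖u + b h‖ ^ q ∂μ := by
        have h1 : ‖u‖ ≤ ∫ h, ‖u + b h‖ ∂μ := by
          have h2 : ∫ h, (u + b h) ∂μ = u := by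
            rw [integral_add (integrable_const _) (hμint hbc), hharm]
            simp
          calc ‖u‖ = ‖∫ h, (u + b h) ∂μ‖ := by rw [h2]
            _ ≤ _ := norm_integral_le_integral_norm _
        exact (Real.rpow_le_rpow (norm_nonneg _) h1 hq0).trans
          (rpow_integral_le (fun _ => norm_nonneg _) hq.le
            (hμint' (continuous_const.add hbc).norm) (hμint' (hpow (continuous_const.add hbc))))
      calc ∫ h, ‖b (g * h)‖ ^ q ∂μ
          ≤ ∫ h, (2 * ‖u‖ ^ q + d / 2 * 2 ^ q * ‖b h‖ ^ q - ‖u + b h‖ ^ q) ∂μ := by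
            refine integral_mono (hμint' (hpow (hbc.comp (continuous_const_mul g))))
              (hμint' ((continuous_const.add (continuous_const.mul (hpow hbc))).sub
                (hpow (continuous_const.add hbc)))) fun h => ?_
            simp only
            rw [norm_mul_of_norm_inv_mul hb]
            exact hE.rpow_norm_sub_le _ _
        _ = 2 * ‖u‖ ^ q + d / 2 * 2 ^ q * V - ∫ h, ‖u + b h‖ ^ q ∂μ := by
            rw [integral_sub (f := fun h => 2 * ‖u‖ ^ q + d / 2 * 2 ^ q * ‖b h‖ ^ q)
              (g := fun h => ‖u + b h‖ ^ q)
              (hμint' (continuous_const.add (continuous_const.mul (hpow hbc))))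
              (hμint' (hpow (continuous_const.add hbc))), integral_add (integrable_const _)
              ((hμint' (hpow hbc)).const_mul _)]
            simp only [integral_const_mul, integral_const, probReal_univ, one_smul, hV]
        _ ≤ ‖u‖ ^ q + d / 2 * 2 ^ q * V := by linarith
        _ = ‖b g‖ ^ q + d / 2 * 2 ^ q * V := by rw [hu, norm_inv_of_norm_inv_mul hb]
    calc ∫ g, ∫ h, ‖b (g * h)‖ ^ q ∂μ ∂(convPow μ k)
        ≤ ∫ g, (‖b g‖ ^ q + d / 2 * 2 ^ q * V) ∂(convPow μ k) :=
          integral_mono_of_nonneg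
            (Eventually.of_forall fun g => integral_nonneg fun h => by positivity)
            (((hpow hbc).add continuous_const).integrable_convPow hcomp hμS k)
            (Eventually.of_forall hstep)
      _ = ∫ g, ‖b g‖ ^ q ∂(convPow μ k) + d / 2 * 2 ^ q * V := by
          rw [integral_add ((hpow hbc).integrable_convPow hcomp hμS k) (integrable_const _)]
          simp
      _ ≤ d / 2 * 2 ^ q * ((k + 1 : ℕ) : ℝ) * V := by push_cast; linarith

end UniformlySmooth

/-! ### Second moments in Hilbert spaces -/

section Hilbert

variable {G : Type*} [Group G] [TopologicalSpace G] [IsTopologicalGroup G] [T2Space G]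
  [SecondCountableTopology G] [MeasurableSpace G] [BorelSpace G]
  {μ : Measure G} [IsProbabilityMeasure μ] {S : Set G}
  {H : Type*} [NormedAddCommGroup H] {b : G → H}

/-- By symmetry `X_{2k}` has the law of `g⁻¹h` with `g`, `h` independent copies of `X_k`. Expanding
`‖b(h) - b(g)‖²`, the cross term averages to `-2‖v‖² ≤ 0`, where `v` is the mean of `b(X_k)`. -/
lemma sq_moment_double_le [InnerProductSpace ℝ H] [CompleteSpace H]
    (hsymm : μ.map (fun g => g⁻¹) = μ) (hcomp : IsCompact S)
    (hμS : μ Sᶜ = 0) (hbc : Continuous b) (hb : ∀ g h, ‖b (g⁻¹ * h)‖ = ‖b h - b g‖) (k : ℕ) :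
    ∫ g, ‖b g‖ ^ 2 ∂(convPow μ (k + k)) ≤ 2 * ∫ g, ‖b g‖ ^ 2 ∂(convPow μ k) := by
  set ν := convPow μ k with hν
  have hint : ∀ {f : G → ℝ}, Continuous f → Integrable f ν := fun hf =>
    hf.integrable_convPow hcomp hμS k
  have hbint : Integrable b ν := hbc.integrable_convPow hcomp hμS k
  set W := ∫ g, ‖b g‖ ^ 2 ∂ν with hW
  set v := ∫ g, b g ∂ν with hv
  have hconv := (continuous_norm_sq hbc).integrable_convPow hcomp hμS (k + k)
  rw [convPow_add] at hconv ⊢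
  have hinv : ∀ F : G → ℝ, ∫ g, F g ∂ν = ∫ g, F g⁻¹ ∂ν := by
    intro F
    conv_lhs => rw [hν, ← map_inv_convPow μ hsymm k]
    exact integral_map_equiv (MeasurableEquiv.inv G) F
  rw [integral_mconv hconv, hinv]
  have hinner : ∀ g, ∫ h, ‖b (g⁻¹ * h)‖ ^ 2 ∂ν = W - 2 * inner ℝ (b g) v + ‖b g‖ ^ 2 := by
    intro g
    have e : ∀ h, ‖b (g⁻¹ * h)‖ ^ 2 = ‖b h‖ ^ 2 - 2 * inner ℝ (b g) (b h) + ‖b g‖ ^ 2 := by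
      intro h
      rw [hb, norm_sub_sq_real, real_inner_comm]
    have hi : Integrable (fun h => 2 * inner ℝ (b g) (b h)) ν :=
      (hbint.const_inner (b g)).const_mul 2
    simp only [e]
    rw [integral_add (f := fun h => ‖b h‖ ^ 2 - 2 * inner ℝ (b g) (b h))
      ((hint (continuous_norm_sq hbc)).sub hi) (integrable_const _),
      integral_sub (hint (continuous_norm_sq hbc)) hi, integral_const_mul, integral_inner hbint]
    simp [hW, hv]
  rw [integral_congr_ae (Eventually.of_forall hinner)]
  have hi : Integrable (fun g => 2 * inner ℝ (b g) v) ν := (hbint.inner_const v).const_mul 2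
  rw [integral_add (f := fun g => W - 2 * inner ℝ (b g) v) ((integrable_const _).sub hi) (hint (continuous_norm_sq hbc)),
    integral_sub (integrable_const _) hi, integral_const_mul]
  have e : ∫ g, inner ℝ (b g) v ∂ν = inner ℝ v v := by
    simp_rw [real_inner_comm v]
    rw [integral_inner hbint]
  rw [e]
  have := real_inner_self_nonneg (x := v)
  simp only [integral_const, probReal_univ, one_smul]
  linarith

/-- Minkowski's inequality in `L²`, from subadditivity of `‖b‖` and Cauchy–Schwarz; it handles odd
times. -/
lemma sqrt_sq_moment_succ_le (hcomp : IsCompact S)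
    (hμS : μ Sᶜ = 0) (hbc : Continuous b) (hb : ∀ g h, ‖b (g⁻¹ * h)‖ = ‖b h - b g‖) (k : ℕ) :
    √(∫ g, ‖b g‖ ^ 2 ∂(convPow μ (k + 1))) ≤
      √(∫ g, ‖b g‖ ^ 2 ∂(convPow μ k)) + √(∫ g, ‖b g‖ ^ 2 ∂μ) := by
  set ν := convPow μ k with hν
  have hint : ∀ {f : G → ℝ}, Continuous f → Integrable f ν := fun hf =>
    hf.integrable_convPow hcomp hμS k
  have hμint : ∀ {f : G → ℝ}, Continuous f → Integrable f μ := fun hf =>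
    hf.integrable_of_compl_isCompact_null hcomp hμS
  have hCS : ∀ (ρ : Measure G) [IsProbabilityMeasure ρ], (∀ {f : G → ℝ}, Continuous f →
      Integrable f ρ) → ∫ g, ‖b g‖ ∂ρ ≤ √(∫ g, ‖b g‖ ^ 2 ∂ρ) := by
    intro ρ _ hρ
    refine Real.le_sqrt_of_sq_le ?_
    have := rpow_integral_le (ν := ρ) (f := fun g => ‖b g‖) (fun _ => norm_nonneg _)
      (q := 2) (by norm_num) (hρ hbc.norm)
      (by simpa only [Real.rpow_two] using hρ (continuous_norm_sq hbc))
    simpa only [Real.rpow_two] using this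
  have h1 := hCS ν hint
  have h2 := hCS μ hμint
  set W := ∫ g, ‖b g‖ ^ 2 ∂ν with hW
  set V := ∫ g, ‖b g‖ ^ 2 ∂μ with hV
  have hW0 : 0 ≤ W := integral_nonneg fun g => by positivity
  have hV0 : 0 ≤ V := integral_nonneg fun g => by positivity
  have hm0 : 0 ≤ ∫ g, ‖b g‖ ∂μ := integral_nonneg fun g => by positivity
  set m := ∫ g, ‖b g‖ ∂μ with hm
  refine Real.sqrt_le_left (by positivity) |>.2 ?_
  rw [convPow, integral_mconv ((continuous_norm_sq hbc).integrable_convPow hcomp hμS (k + 1))]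
  have hstep : ∀ g, ∫ h, ‖b (g * h)‖ ^ 2 ∂μ ≤ ‖b g‖ ^ 2 + 2 * m * ‖b g‖ + V := by
    intro g
    calc ∫ h, ‖b (g * h)‖ ^ 2 ∂μ ≤ ∫ h, (‖b g‖ ^ 2 + 2 * ‖b g‖ * ‖b h‖ + ‖b h‖ ^ 2) ∂μ := by
          refine integral_mono (hμint ((hbc.comp (continuous_const_mul g)).norm.pow 2))
            (hμint (by fun_prop)) fun h => ?_
          have := pow_le_pow_left₀ (norm_nonneg _) (norm_mul_le_of_norm_inv_mul hb g h) 2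
          simp only
          linarith
      _ = _ := by
          rw [integral_add (hμint (by fun_prop)) (hμint (by fun_prop)),
            integral_add (integrable_const _) (hμint (by fun_prop)), integral_const_mul]
          simp only [integral_const, probReal_univ, one_smul]
          ring
  calc ∫ g, ∫ h, ‖b (g * h)‖ ^ 2 ∂μ ∂ν ≤ ∫ g, (‖b g‖ ^ 2 + 2 * m * ‖b g‖ + V) ∂ν :=
        integral_mono_of_nonneg
          (Eventually.of_forall fun g => integral_nonneg fun h => by positivity)
          (hint (by fun_prop)) (Eventually.of_forall hstep)
    _ = W + 2 * m * ∫ g, ‖b g‖ ∂ν + V := by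
        rw [integral_add (hint (by fun_prop)) (integrable_const _),
          integral_add (hint (by fun_prop)) (hint (by fun_prop)), integral_const_mul]
        simp [hW]
    _ ≤ W + 2 * (√V * √W) + V := by
        have := mul_le_mul h2 h1 (integral_nonneg fun g => by positivity) (Real.sqrt_nonneg V)
        linarith
    _ = (√W + √V) ^ 2 := by
        rw [add_sq, Real.sq_sqrt hW0, Real.sq_sqrt hV0]
        ring

lemma sqrt_sq_moment_le [InnerProductSpace ℝ H] [CompleteSpace H]
    (hsymm : μ.map (fun g => g⁻¹) = μ) (hcomp : IsCompact S)
    (hμS : μ Sᶜ = 0) (hbc : Continuous b) (hb : ∀ g h, ‖b (g⁻¹ * h)‖ = ‖b h - b g‖) (k : ℕ)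
    (hk : 1 ≤ k) :
    √(∫ g, ‖b g‖ ^ 2 ∂(convPow μ k)) ≤ (4 * √k - 3) * √(∫ g, ‖b g‖ ^ 2 ∂μ) := by
  induction k using Nat.strong_induction_on with
  | _ k ih =>
    set r := √(∫ g, ‖b g‖ ^ 2 ∂μ) with hr
    have hr0 : 0 ≤ r := Real.sqrt_nonneg _
    -- The `-3` is slack for the odd step: doubling turns it into `-3√2 ≤ -4`, which pays for one
    -- extra increment.
    have hs2 : (4 / 3 : ℝ) ≤ √2 := Real.le_sqrt_of_sq_le (by norm_num)
    have hdouble : ∀ m : ℕ, m < k → 1 ≤ m →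
        √(∫ g, ‖b g‖ ^ 2 ∂(convPow μ (m + m))) ≤ (4 * √((m + m : ℕ) : ℝ) - 3 * √2) * r := by
      intro m hm hm1
      calc _ ≤ √(2 * ∫ g, ‖b g‖ ^ 2 ∂(convPow μ m)) :=
            Real.sqrt_le_sqrt (sq_moment_double_le hsymm hcomp hμS hbc hb m)
        _ = √2 * √(∫ g, ‖b g‖ ^ 2 ∂(convPow μ m)) := Real.sqrt_mul (by norm_num) _
        _ ≤ √2 * ((4 * √m - 3) * r) := by gcongr; exact ih m hm hm1
        _ = _ := by
            rw [show ((m + m : ℕ) : ℝ) = 2 * m by push_cast; ring, Real.sqrt_mul (by norm_num)]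
            ring
    rcases Nat.even_or_odd' k with ⟨m, rfl | rfl⟩
    · have h := hdouble m (by omega) (by omega)
      rw [← two_mul] at h
      refine h.trans (mul_le_mul_of_nonneg_right ?_ hr0)
      linarith
    · rcases Nat.eq_zero_or_pos m with rfl | hm
      · simp only [mul_zero, zero_add, convPow_one, Nat.cast_one, Real.sqrt_one]
        linarith
      · have h := hdouble m (by omega) hm
        rw [← two_mul] at h
        have h2 := sqrt_sq_moment_succ_le hcomp hμS hbc hb (2 * m)
        have h3 : √((2 * m : ℕ) : ℝ) ≤ √((2 * m + 1 : ℕ) : ℝ) :=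
          Real.sqrt_le_sqrt (by exact_mod_cast Nat.le_succ _)
        nlinarith

lemma sq_moment_le [InnerProductSpace ℝ H] [CompleteSpace H]
    (hsymm : μ.map (fun g => g⁻¹) = μ) (hcomp : IsCompact S)
    (hμS : μ Sᶜ = 0) (hbc : Continuous b) (hb : ∀ g h, ‖b (g⁻¹ * h)‖ = ‖b h - b g‖) (k : ℕ) :
    ∫ g, ‖b g‖ ^ (2 : ℝ) ∂(convPow μ k) ≤ 16 * k * ∫ g, ‖b g‖ ^ (2 : ℝ) ∂μ := by
  simp only [Real.rpow_two]
  rcases Nat.eq_zero_or_pos k with rfl | hk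
  · rw [convPow, integral_dirac, map_one_of_norm_inv_mul hb]
    simp
  have hV0 : 0 ≤ ∫ g, ‖b g‖ ^ 2 ∂μ := integral_nonneg fun g => by positivity
  have h : √(∫ g, ‖b g‖ ^ 2 ∂(convPow μ k)) ≤ 4 * √k * √(∫ g, ‖b g‖ ^ 2 ∂μ) := by
    refine (sqrt_sq_moment_le hsymm hcomp hμS hbc hb k hk).trans ?_
    gcongr
    linarith
  refine ((Real.sqrt_le_left (by positivity)).1 h).trans (le_of_eq ?_)
  rw [mul_pow, mul_pow, Real.sq_sqrt hV0, Real.sq_sqrt (Nat.cast_nonneg k)]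
  norm_num

end Hilbert

/-! ### Cocycles and the main theorem -/

lemma IsCocycle.norm_inv_mul {G 𝕜 E : Type*} [Group G] [TopologicalSpace G] [RCLike 𝕜]
    [NormedAddCommGroup E] [NormedSpace 𝕜 E] {π : G →* (E ≃ₗᵢ[𝕜] E)} {b : G → E}
    (hb : IsCocycle π b) (g h : G) : ‖b (g⁻¹ * h)‖ = ‖b h - b g‖ := by
  have e := hb.map_mul g (g⁻¹ * h)
  rw [mul_inv_cancel_left] at e
  rw [e, add_sub_cancel_left, LinearIsometryEquiv.norm_map]

theorem mainTheorem8 {G : Type*} [Group G] [TopologicalSpace G] [IsTopologicalGroup G] [T2Space G]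
    [LocallyCompactSpace G] [SecondCountableTopology G] [MeasurableSpace G] [BorelSpace G]
    (hunimodular : (Measure.haar : Measure G).IsMulRightInvariant)
    (S : Set G) (μ : Measure G) (hμ : IsCohomologicallyAdapted S μ) (hsupp : μ.support = S)
    (hdrift : 0 < drift S μ) :
    (∃ C : ℝ, 0 < C ∧
      ∀ (𝕜 : Type*) [RCLike 𝕜] (H : Type*) [NormedAddCommGroup H] [InnerProductSpace 𝕜 H]
        [CompleteSpace H] (π : G →* (H ≃ₗᵢ[𝕜] H)) (b : G → H),
        IsContinuousRep π → IsCocycle π b →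
          ∀ n : ℕ, compression S b n ≤ C * cocycleNorm 2 μ b * Real.sqrt n) ∧
    (∀ q d : ℝ, 1 < q → 0 < d →
      ∃ C : ℝ, 0 < C ∧
        ∀ (E : Type*) [NormedAddCommGroup E] [NormedSpace ℝ E] [CompleteSpace E]
          (π : G →* (E ≃ₗᵢ[ℝ] E)) (b : G → E),
          IsUniformlySmooth q d E → IsContinuousRep π → IsCocycle π b → IsHarmonic μ b →
            ∀ n : ℕ, compression S b n ≤ C * cocycleNorm q μ b * (n : ℝ) ^ (1 / q)) := by
  have : IsProbabilityMeasure μ := hμ.isProbabilityMeasure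
  have hμS : μ Sᶜ = 0 := hsupp ▸ Measure.measure_compl_support
  have hS : ∀ g : G, ∃ n : ℕ, g ∈ S ^ n :=
    exists_mem_pow (by rw [← hsupp]; exact inv_support μ hμ.symmetric) hμ.generates
  have hmeas : Measurable (wordLength S) :=
    measurable_wordLength hS fun n => (isCompact_set_pow hμ.isCompact n).measurableSet
  obtain ⟨c, hc, hexit⟩ := exists_linear_exit_time hmeas hdrift
  refine ⟨⟨2 * (4 * 16 * c) ^ (1 / 2 : ℝ), by positivity, ?_⟩, fun q d hq hd =>
    ⟨2 * (4 * (d / 2 * 2 ^ q) * c) ^ (1 / q), by positivity, ?_⟩⟩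
  · intro 𝕜 _ H _ _ _ π b _ hb n
    -- Restricting scalars keeps the norm, and only norms of `b` matter from here on.
    let _ : InnerProductSpace ℝ H := InnerProductSpace.rclikeToReal 𝕜 H
    rw [Real.sqrt_eq_rpow]
    exact compression_le_of_moment_le hμS hS hmeas hb.continuous hb.norm_inv_mul (by norm_num)
      (by norm_num) (fun k => (hb.continuous.norm.rpow_const
        fun _ => Or.inr (by norm_num)).integrable_convPow hμ.isCompact hμS k)
      (sq_moment_le hμ.symmetric hμ.isCompact hμS hb.continuous hb.norm_inv_mul) hexit hc.le n
  · intro E _ _ _ π b hE _ hb hharm n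
    exact compression_le_of_moment_le hμS hS hmeas hb.continuous hb.norm_inv_mul (by linarith)
      (by positivity) (fun k => (hb.continuous.norm.rpow_const
        fun _ => Or.inr (by linarith)).integrable_convPow hμ.isCompact hμS k)
      (moment_le_of_isUniformlySmooth hμ.isCompact hμS hq hE hb.continuous hb.norm_inv_mul hharm)
      hexit hc.le n
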